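/- A subset of $\mathbb R^m$ is called semialgebraic if it belongs to the smallest class of subsets of $\mathbb R^m$ that contains all sets $\{P=0\}$ and $\{P>0\}$ with $P\in\mathbb R[x_1,\dots,x_m]$ and is closed under finite unions, finite intersections and complements. A mapping $Y:\mathbb R^n\to\mathbb R^n$ is called semialgebraic if its graph is a semialgebraic subset of $\mathbb R^n\times\mathbb R^n=\mathbb R^{2n}$. For a continuous mapping $Y:\mathbb R^n\to\mathbb R^n$, let $S_Y$ denote the set of points at which $Y$ is not proper, that is, the set of all $y\in\mathbb R^n$ for which there is no neighborhood $U$ of $y$ such that $Y^{-1}(\overline U)$ is compact. **Proposition 4.5.** If $Y:\mathbb R^n\to\mathbb R^n$ is a continuous semialgebraic mapping, then $S_Y$ is a semialgebraic subset of $\mathbb R^n$. -/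

import Mathlib

/-- The semialgebraic subsets of `ℝ^ι`: the smallest class of subsets that contains the sets
`{P = 0}` and `{P > 0}` for every real polynomial `P` in the coordinates, and that is closed under
finite unions, finite intersections and complements. -/
inductive IsSemialgebraic {ι : Type*} : Set (ι → ℝ) → Prop
  | zeroSet (P : MvPolynomial ι ℝ) : IsSemialgebraic {x | MvPolynomial.eval x P = 0}
  | posSet (P : MvPolynomial ι ℝ) : IsSemialgebraic {x | 0 < MvPolynomial.eval x P}
  | union {A B : Set (ι → ℝ)} : IsSemialgebraic A → IsSemialgebraic B → IsSemialgebraic (A ∪ B)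
  | inter {A B : Set (ι → ℝ)} : IsSemialgebraic A → IsSemialgebraic B → IsSemialgebraic (A ∩ B)
  | compl {A : Set (ι → ℝ)} : IsSemialgebraic A → IsSemialgebraic Aᶜ

/-- A mapping `ℝ^ι → ℝ^κ` is semialgebraic if its graph is a semialgebraic subset of
`ℝ^ι × ℝ^κ`, which is written here as `ℝ^(ι ⊕ κ)`. -/
def IsSemialgebraicMap {ι κ : Type*} (Y : (ι → ℝ) → (κ → ℝ)) : Prop :=
  IsSemialgebraic {z : ι ⊕ κ → ℝ | Y (fun i => z (Sum.inl i)) = fun j => z (Sum.inr j)}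

/-- The set `S_Y` of points at which `Y` is not proper: the points `y` that have no neighborhood
`U` such that the preimage of the closure of `U` is compact. -/
def nonProperPoints {M N : Type*} [TopologicalSpace M] [TopologicalSpace N] (Y : M → N) : Set N :=
  {y | ¬ ∃ U ∈ nhds y, IsCompact (Y ⁻¹' closure U)}

/-!
By continuity, `y ∈ S_Y` exactly if for every `ε > 0` some `x` with `ε * ‖x‖ > 1` has
`‖Y x - y‖ < ε`: a closed preimage fails to be compact only by being unbounded
(`mem_nonProperPoints_iff`). This condition is built from semialgebraic conditions by quantifying
over finitely many real variables, so the statement follows from the Tarski–Seidenberg theorem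
(`IsSemialgebraic.exists_sumElim`), which has to be proved.

The proof of the latter works with tame functions: the functions `ξ : ℝ^ι → ℝ` whose substitution
for a variable preserves semialgebraicity, also in the presence of further parameters. They form an
algebra closed under inversion (`tameSubalgebra`, `IsTame.inv`). The main fact
(`tameSubalgebra.exists_coversRoots`) is that the roots of a one-variable polynomial with tame
coefficients are values of finitely many tame functions, by induction on the degree. One may assume
that `f` is monic. The roots of `f'`, together with bounds for the roots of `f`, cut the line into
intervals on which `f` is strictly monotone, and hence has at most one root `ρ`. To see that `ρ` is
tame, one has to decide the sign of `p(ρ)` for a polynomial `p`. Modulo `f` the degree of `p` is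
smaller than that of `f`, so the roots of `p` are tame by induction, and the sign of `p(ρ)` is that
of `p` at the midpoint of two neighboring samples between which `f` changes sign
(`Polynomial.eval_pos_iff_of_isRoot`).

To project a semialgebraic set along a coordinate `t`, it then suffices to try finitely many tame
functions of the other coordinates for `t`: the roots of the polynomials that define the set, the
midpoints of any two of them, and the roots shifted by `1` and `-1`
(`IsSemialgebraic.exists_samples`).
-/

open Polynomial

/-! ### Boolean combinations and polynomial substitution -/

namespace IsSemialgebraic

variable {ι κ : Type*}

theorem univ : IsSemialgebraic (Set.univ : Set (ι → ℝ)) := by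
  simpa using zeroSet (0 : MvPolynomial ι ℝ)

theorem empty : IsSemialgebraic (∅ : Set (ι → ℝ)) := by
  simpa using (univ (ι := ι)).compl

theorem biUnion_finset {α : Type*} (s : Finset α) {A : α → Set (ι → ℝ)}
    (h : ∀ a ∈ s, IsSemialgebraic (A a)) : IsSemialgebraic {x | ∃ a ∈ s, x ∈ A a} := by
  classical
  induction s using Finset.induction_on with
  | empty => simpa using empty
  | insert a s _ ih =>
    have := (h a (by simp)).union (ih fun b hb => h b (by simp [hb]))
    convert this using 1
    ext x
    simp

theorem biInter_finset {α : Type*} (s : Finset α) {A : α → Set (ι → ℝ)}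
    (h : ∀ a ∈ s, IsSemialgebraic (A a)) : IsSemialgebraic {x | ∀ a ∈ s, x ∈ A a} := by
  convert (biUnion_finset s fun a ha => (h a ha).compl).compl using 1
  ext x
  simp

/-- Preimages of semialgebraic sets under polynomial maps are semialgebraic. -/
theorem preimage_eval {S : Set (κ → ℝ)} (hS : IsSemialgebraic S) (p : κ → MvPolynomial ι ℝ) :
    IsSemialgebraic {x : ι → ℝ | (fun k => MvPolynomial.eval x (p k)) ∈ S} := by
  have key (P : MvPolynomial κ ℝ) (x : ι → ℝ) :
      MvPolynomial.eval (fun k => MvPolynomial.eval x (p k)) P =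
        MvPolynomial.eval x (MvPolynomial.bind₁ p P) := by
    rw [MvPolynomial.eval, MvPolynomial.eval, MvPolynomial.eval₂Hom_bind₁]
  induction hS with
  | zeroSet P => simpa only [Set.mem_ofPred_eq, key] using zeroSet _
  | posSet P => simpa only [Set.mem_ofPred_eq, key] using posSet _
  | union _ _ hA hB => exact hA.union hB
  | inter _ _ hA hB => exact hA.inter hB
  | compl _ hA => exact hA.compl

theorem preimage_comp {S : Set (κ → ℝ)} (hS : IsSemialgebraic S) (π : κ → ι) :
    IsSemialgebraic {x : ι → ℝ | x ∘ π ∈ S} := by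
  simpa [Function.comp_def] using hS.preimage_eval fun k => MvPolynomial.X (π k)

end IsSemialgebraic

/-! ### The algebra of tame functions -/

/-- The point of `ℝ^(Option κ)` with coordinates `y` and last coordinate `t`. -/
def snocPoint {κ : Type*} (y : κ → ℝ) (t : ℝ) : Option κ → ℝ := fun o => o.elim t y

@[simp] theorem snocPoint_none {κ : Type*} (y : κ → ℝ) (t : ℝ) : snocPoint y t none = t := rfl

@[simp] theorem snocPoint_some {κ : Type*} (y : κ → ℝ) (t : ℝ) (k : κ) :
    snocPoint y t (some k) = y k := rfl

/-- A function `ξ` is tame if substituting `ξ` for a variable turns semialgebraic sets into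
semialgebraic sets. The set may depend on more variables `y : κ → ℝ` than `ξ` does; the map `π`
selects the ones that `ξ` takes. These additional parameters are what makes tame functions closed
under the ring operations. -/
def IsTame {ι : Type} (ξ : (ι → ℝ) → ℝ) : Prop :=
  ∀ ⦃κ : Type⦄ (π : ι → κ) ⦃S : Set (Option κ → ℝ)⦄, IsSemialgebraic S →
    IsSemialgebraic {y : κ → ℝ | snocPoint y (ξ (y ∘ π)) ∈ S}

namespace IsTame

variable {ι : Type}

theorem comp_reindex {ξ : (ι → ℝ) → ℝ} (hξ : IsTame ξ) {κ : Type} (π : ι → κ) :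
    IsTame fun y : κ → ℝ => ξ (y ∘ π) :=
  fun _ σ _ hS => hξ (σ ∘ π) hS

theorem of_eval (p : MvPolynomial ι ℝ) : IsTame fun x => MvPolynomial.eval x p := by
  intro κ π S hS
  convert hS.preimage_eval
    (fun o : Option κ => o.elim (MvPolynomial.rename π p) MvPolynomial.X) using 3 with y
  congr! 1
  ext (_ | k)
  · simp [MvPolynomial.eval_rename]
  · simp

/-- Substituting two tame functions one after the other. -/
theorem eval₂ {ξ η : (ι → ℝ) → ℝ} (hξ : IsTame ξ) (hη : IsTame η) (q : MvPolynomial Bool ℝ) :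
    IsTame fun x => MvPolynomial.eval (fun b => bif b then ξ x else η x) q := by
  intro κ π S hS
  have h₁ := hS.preimage_eval (ι := Option (Option κ)) (fun o => o.elim
    (MvPolynomial.rename (fun b : Bool => bif b then some none else none) q)
    (fun k => MvPolynomial.X (some (some k))))
  convert hξ π (hη (some ∘ π) h₁) using 3 with y
  simp only [Set.mem_ofPred_eq]
  congr! 1
  ext (_ | k)
  · simp only [snocPoint_none, Option.elim_none, MvPolynomial.eval_rename]
    congr 2
    ext b
    cases b <;> rfl
  · simp

theorem add {ξ η : (ι → ℝ) → ℝ} (hξ : IsTame ξ) (hη : IsTame η) : IsTame (ξ + η) := by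
  convert hξ.eval₂ hη (MvPolynomial.X true + MvPolynomial.X false) using 2 with x
  simp

theorem mul {ξ η : (ι → ℝ) → ℝ} (hξ : IsTame ξ) (hη : IsTame η) : IsTame (ξ * η) := by
  convert hξ.eval₂ hη (MvPolynomial.X true * MvPolynomial.X false) using 2 with x
  simp

theorem const (c : ℝ) : IsTame fun _ : ι → ℝ => c := by
  simpa using of_eval (ι := ι) (MvPolynomial.C c)

theorem coord (i : ι) : IsTame fun x : ι → ℝ => x i := by
  simpa using of_eval (MvPolynomial.X i)

theorem isSemialgebraic_mem {ξ : (ι → ℝ) → ℝ} (hξ : IsTame ξ) {S : Set (Option ι → ℝ)}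
    (hS : IsSemialgebraic S) : IsSemialgebraic {x | snocPoint x (ξ x) ∈ S} :=
  hξ id hS

end IsTame

/-- The tame functions on `ℝ^ι`, as a subalgebra of all functions. -/
def tameSubalgebra (ι : Type) : Subalgebra ℝ ((ι → ℝ) → ℝ) where
  carrier := {ξ | IsTame ξ}
  mul_mem' := IsTame.mul
  add_mem' := IsTame.add
  algebraMap_mem' c := IsTame.const c

namespace tameSubalgebra

variable {ι κ : Type}

theorem isSemialgebraic_pos (ξ : tameSubalgebra ι) : IsSemialgebraic {x | 0 < ξ.1 x} := by
  simpa using ξ.2.isSemialgebraic_mem (.posSet (MvPolynomial.X none))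

theorem isSemialgebraic_lt (ξ η : tameSubalgebra ι) : IsSemialgebraic {x | ξ.1 x < η.1 x} := by
  simpa using isSemialgebraic_pos (η - ξ)

theorem isSemialgebraic_eq_zero (ξ : tameSubalgebra ι) : IsSemialgebraic {x | ξ.1 x = 0} := by
  convert ((isSemialgebraic_lt ξ 0).union (isSemialgebraic_lt 0 ξ)).compl using 1
  ext x
  simp [le_antisymm_iff, and_comm]

/-- Evaluation of tame functions at a point. -/
def evalAt (x : ι → ℝ) : tameSubalgebra ι →+* ℝ :=
  (Pi.evalRingHom (fun _ : ι → ℝ => ℝ) x).comp (tameSubalgebra ι).val.toRingHom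

@[simp] theorem evalAt_apply (x : ι → ℝ) (ξ : tameSubalgebra ι) : evalAt x ξ = ξ.1 x := rfl

/-- Pulling back tame functions along a choice of variables. -/
def reindex (π : ι → κ) : tameSubalgebra ι →+* tameSubalgebra κ where
  toFun ξ := ⟨fun y => ξ.1 (y ∘ π), ξ.2.comp_reindex π⟩
  map_one' := rfl
  map_mul' _ _ := rfl
  map_zero' := rfl
  map_add' _ _ := rfl

@[simp] theorem reindex_apply (π : ι → κ) (ξ : tameSubalgebra ι) (y : κ → ℝ) :
    (reindex π ξ).1 y = ξ.1 (y ∘ π) := rfl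

/-- The real polynomial obtained from a polynomial with tame coefficients at a point. -/
noncomputable def fiber (p : (tameSubalgebra ι)[X]) (x : ι → ℝ) : ℝ[X] := p.map (evalAt x)

theorem fiber_reindex (p : (tameSubalgebra ι)[X]) (π : ι → κ) (y : κ → ℝ) :
    fiber (p.map (reindex π)) y = fiber p (y ∘ π) := by
  rw [fiber, fiber, Polynomial.map_map]
  rfl

@[simp] theorem evalAt_eval (p : (tameSubalgebra ι)[X]) (ξ : tameSubalgebra ι) (x : ι → ℝ) :
    (p.eval ξ).1 x = (fiber p x).eval (ξ.1 x) := by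
  rw [fiber, ← evalAt_apply x (p.eval ξ), ← evalAt_apply x ξ, eval_map, eval₂_at_apply]

/-- A real polynomial in `Option κ` variables, as a polynomial in the last variable. -/
noncomputable def ofMvPolynomial : MvPolynomial (Option κ) ℝ →ₐ[ℝ] (tameSubalgebra κ)[X] :=
  MvPolynomial.aeval fun o => o.elim X fun k => C ⟨fun y => y k, IsTame.coord k⟩

theorem eval_fiber_ofMvPolynomial (P : MvPolynomial (Option κ) ℝ) (y : κ → ℝ) (t : ℝ) :
    (fiber (ofMvPolynomial P) y).eval t = MvPolynomial.eval (snocPoint y t) P := by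
  unfold fiber ofMvPolynomial
  induction P using MvPolynomial.induction_on with
  | C a =>
    rw [MvPolynomial.aeval_C, MvPolynomial.eval_C, Polynomial.algebraMap_apply, map_C, eval_C]
    rfl
  | add p q hp hq => simp only [map_add, Polynomial.map_add, eval_add, hp, hq]
  | mul_X p o hp =>
    rw [map_mul, Polynomial.map_mul, eval_mul, hp, MvPolynomial.aeval_X, map_mul,
      MvPolynomial.eval_X]
    cases o <;> simp

end tameSubalgebra

/-- Tameness need only be tested on positivity of polynomials with tame coefficients. -/
theorem IsTame.of_polynomial {ι : Type} {ξ : (ι → ℝ) → ℝ}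
    (h : ∀ (κ : Type) (π : ι → κ) (p : (tameSubalgebra κ)[X]),
      IsSemialgebraic {y : κ → ℝ | 0 < (tameSubalgebra.fiber p y).eval (ξ (y ∘ π))}) :
    IsTame ξ := by
  intro κ π S hS
  have pos (P : MvPolynomial (Option κ) ℝ) :
      IsSemialgebraic {y : κ → ℝ | 0 < MvPolynomial.eval (snocPoint y (ξ (y ∘ π))) P} := by
    simpa only [tameSubalgebra.eval_fiber_ofMvPolynomial] using
      h κ π (tameSubalgebra.ofMvPolynomial P)
  induction hS with
  | posSet P => exact pos P
  | zeroSet P =>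
    convert ((pos P).union (pos (-P))).compl using 1
    ext y
    simp [le_antisymm_iff]
  | union _ _ hA hB => exact hA.union hB
  | inter _ _ hA hB => exact hA.inter hB
  | compl _ hA => exact hA.compl

/-- The pointwise inverse (with `0⁻¹ = 0`) of a tame function is tame: away from the zeros of `ξ`,
the sign of `p(ξ⁻¹)` is that of `p(ξ⁻¹) * ξ ^ (2 * natDegree p)`, a polynomial in `ξ`. -/
theorem IsTame.inv {ι : Type} {ξ : (ι → ℝ) → ℝ} (hξ : IsTame ξ) : IsTame fun x => (ξ x)⁻¹ := by
  refine .of_polynomial fun κ π p => ?_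
  let η : tameSubalgebra κ := ⟨fun y => ξ (y ∘ π), hξ.comp_reindex π⟩
  have hη := tameSubalgebra.isSemialgebraic_eq_zero η
  convert (hη.inter (tameSubalgebra.isSemialgebraic_pos (p.eval 0))).union
    (hη.compl.inter (tameSubalgebra.isSemialgebraic_pos
      (p.reverse.eval η * η ^ p.natDegree))) using 1
  ext y
  have hy : η.1 y = ξ (y ∘ π) := rfl
  simp only [Set.mem_ofPred_eq, Set.mem_union, Set.mem_inter_iff, Set.mem_compl_iff]
  by_cases h : η.1 y = 0
  · simp [h, ← hy]
  · have key : (tameSubalgebra.fiber p.reverse y).eval (η.1 y) * (η.1 y)⁻¹ ^ p.natDegree =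
        (tameSubalgebra.fiber p y).eval (η.1 y)⁻¹ := by
      let : Invertible (η.1 y)⁻¹ := invertibleOfNonzero (inv_ne_zero h)
      have := eval₂_reverse_mul_pow (tameSubalgebra.evalAt y) (η.1 y)⁻¹ p
      rw [invOf_eq_inv, inv_inv] at this
      simpa only [tameSubalgebra.fiber, eval_map] using this
    have hpos : 0 < (η.1 y ^ p.natDegree) ^ 2 := by positivity
    simp only [h, false_and, not_false_eq_true, true_and, false_or]
    rw [← hy, ← key, ← mul_pos_iff_of_pos_right hpos]
    simp only [Subalgebra.coe_mul, Subalgebra.coe_pow, Pi.mul_apply, Pi.pow_apply,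
      tameSubalgebra.evalAt_eval]
    rw [show ∀ a : ℝ, a * (η.1 y)⁻¹ ^ p.natDegree * (η.1 y ^ p.natDegree) ^ 2 =
      a * η.1 y ^ p.natDegree by
        intro a
        rw [inv_pow]
        field_simp]

/-! ### Real polynomials between sample points -/

namespace Polynomial

/-- A polynomial without zeros on `[a, b]` has the same sign at both ends. -/
theorem eval_mul_eval_pos_of_forall_ne_zero (p : ℝ[X]) {a b : ℝ} (hab : a ≤ b)
    (h : ∀ t ∈ Set.Icc a b, p.eval t ≠ 0) : 0 < p.eval a * p.eval b := by
  by_contra! hneg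
  have hc : ContinuousOn (fun t => p.eval t) (Set.Icc a b) := p.continuous.continuousOn
  have hne : p.eval a ≠ 0 := h a (Set.left_mem_Icc.2 hab)
  have h0 : (0 : ℝ) ∈ Set.uIcc (p.eval a) (p.eval b) := by
    rw [Set.mem_uIcc]
    rcases hne.lt_or_gt with ha | ha
    · exact Or.inl ⟨ha.le, by nlinarith⟩
    · exact Or.inr ⟨by nlinarith, ha.le⟩
  obtain ⟨t, ht, h0⟩ := intermediate_value_uIcc (by rwa [Set.uIcc_of_le hab]) h0
  exact h t (by rwa [Set.uIcc_of_le hab] at ht) h0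

theorem exists_isRoot_of_mul_neg (p : ℝ[X]) {a b : ℝ} (hab : a < b)
    (h : p.eval a * p.eval b < 0) : ∃ t ∈ Set.Ioo a b, p.IsRoot t := by
  by_contra! hne
  refine (p.eval_mul_eval_pos_of_forall_ne_zero hab.le fun t ht h0 => ?_).not_gt h
  rcases eq_or_ne t a with rfl | hta
  · simp [h0] at h
  rcases eq_or_ne t b with rfl | htb
  · simp [h0] at h
  exact hne t ⟨lt_of_le_of_ne ht.1 hta.symm, lt_of_le_of_ne ht.2 htb⟩ h0

theorem strictMonoOn_or_strictAntiOn_Icc (p : ℝ[X]) {u v : ℝ}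
    (h : ∀ t ∈ Set.Ioo u v, p.derivative.eval t ≠ 0) :
    StrictMonoOn (fun t => p.eval t) (Set.Icc u v) ∨
      StrictAntiOn (fun t => p.eval t) (Set.Icc u v) := by
  have hc : ContinuousOn (fun t => p.eval t) (Set.Icc u v) := p.continuous.continuousOn
  rcases hasDerivWithinAt_forall_lt_or_forall_gt_of_forall_ne (convex_Ioo u v)
    (fun t _ => (p.hasDerivAt t).hasDerivWithinAt) h with h | h
  · exact .inr (strictAntiOn_of_deriv_neg (convex_Icc u v) hc fun t ht => by
      rw [interior_Icc] at ht; simpa using h t ht)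
  · exact .inl (strictMonoOn_of_deriv_pos (convex_Icc u v) hc fun t ht => by
      rw [interior_Icc] at ht; simpa using h t ht)

/-- A strictly monotone polynomial changes sign across a root. -/
theorem eval_mul_eval_neg_of_monotone (p : ℝ[X]) {u v t a b : ℝ}
    (h : StrictMonoOn (fun t => p.eval t) (Set.Icc u v) ∨
      StrictAntiOn (fun t => p.eval t) (Set.Icc u v))
    (ht : p.IsRoot t) (hua : u ≤ a) (hat : a < t) (htb : t < b) (hbv : b ≤ v) :
    p.eval a * p.eval b < 0 := by
  have ha : a ∈ Set.Icc u v := ⟨hua, by linarith⟩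
  have ht' : t ∈ Set.Icc u v := ⟨by linarith, by linarith⟩
  have hb : b ∈ Set.Icc u v := ⟨by linarith, hbv⟩
  have h0 : p.eval t = 0 := ht
  rcases h with h | h
  · have h1 := h ha ht' hat
    have h2 := h ht' hb htb
    simp only [h0] at h1 h2
    exact mul_neg_of_neg_of_pos h1 h2
  · have h1 := h ha ht' hat
    have h2 := h ht' hb htb
    simp only [h0] at h1 h2
    exact mul_neg_of_pos_of_neg h1 h2

end Polynomial

/-- Two elements of a finite set enclosing `t` with no other element between them, except possibly
`t` itself. -/
theorem Finset.exists_neighbors (E : Finset ℝ) {t u v : ℝ} (hu : u ∈ E) (hv : v ∈ E) (hut : u < t)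
    (htv : t < v) : ∃ a ∈ E, ∃ b ∈ E, u ≤ a ∧ b ≤ v ∧ a < t ∧ t < b ∧
      ∀ z ∈ E, a < z → z < b → z = t := by
  obtain ⟨a, ha, hamax⟩ := (E.filter (· < t)).exists_max_image id ⟨u, by simp [hu, hut]⟩
  obtain ⟨b, hb, hbmin⟩ := (E.filter (t < ·)).exists_min_image id ⟨v, by simp [hv, htv]⟩
  simp only [Finset.mem_filter, id_eq, and_imp] at ha hamax hb hbmin
  refine ⟨a, ha.1, b, hb.1, hamax u hu hut, hbmin v hv htv, ha.2, hb.2, fun z hz haz hzb => ?_⟩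
  rcases lt_trichotomy z t with h | h | h
  · exact absurd (hamax z hz h) haz.not_ge
  · exact h
  · exact absurd (hbmin z hz h) hzb.not_ge

/-- The sign of `q` at the only root `t` of `p` in `(u, v)`, read off at sample points: `p` changes
sign between two neighboring samples exactly if they enclose `t`, and `q` has no root there. -/
theorem Polynomial.eval_pos_iff_of_isRoot {p q : ℝ[X]} {u v t : ℝ}
    (hp : StrictMonoOn (fun t => p.eval t) (Set.Icc u v) ∨
      StrictAntiOn (fun t => p.eval t) (Set.Icc u v))
    (ht : p.IsRoot t) (hut : u < t) (htv : t < v) {E : Finset ℝ} (hu : u ∈ E) (hv : v ∈ E)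
    (hE : q ≠ 0 → ∀ z, q.IsRoot z → z ∈ E) :
    0 < q.eval t ↔ ∃ a ∈ E, ∃ b ∈ E, ¬ a < u ∧ a < b ∧ ¬ v < b ∧ p.eval a * p.eval b < 0 ∧
      (∀ z ∈ E, ¬ (q.eval z = 0 ∧ a < z ∧ z < b)) ∧ 0 < q.eval ((a + b) / 2) := by
  have sign {a b : ℝ} (hz : ∀ z ∈ E, ¬ (q.eval z = 0 ∧ a < z ∧ z < b)) (hq : q ≠ 0) {c d : ℝ}
      (hc : a < c) (hcd : c ≤ d) (hd : d < b) : 0 < q.eval c * q.eval d :=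
    q.eval_mul_eval_pos_of_forall_ne_zero hcd fun z hz' h0 =>
      hz z (hE hq z h0) ⟨h0, hc.trans_le hz'.1, hz'.2.trans_lt hd⟩
  have sign' {a b : ℝ} (hat : a < t) (htb : t < b)
      (hz : ∀ z ∈ E, ¬ (q.eval z = 0 ∧ a < z ∧ z < b)) (hq : q ≠ 0) :
      0 < q.eval t * q.eval ((a + b) / 2) := by
    rcases le_total t ((a + b) / 2) with h | h
    · exact sign hz hq hat h (by linarith)
    · rw [mul_comm]
      exact sign hz hq (by linarith) h htb
  constructor
  · intro hpos
    have hq : q ≠ 0 := by rintro rfl; simp at hpos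
    obtain ⟨a, ha, b, hb, hua, hbv, hat, htb, hab⟩ := E.exists_neighbors hu hv hut htv
    have hz : ∀ z ∈ E, ¬ (q.eval z = 0 ∧ a < z ∧ z < b) := by
      rintro z hz ⟨h0, haz, hzb⟩
      rw [hab z hz haz hzb] at h0
      exact hpos.ne' h0
    exact ⟨a, ha, b, hb, hua.not_gt, hat.trans htb, hbv.not_gt,
      p.eval_mul_eval_neg_of_monotone hp ht hua hat htb hbv, hz,
      (pos_iff_pos_of_mul_pos (sign' hat htb hz hq)).1 hpos⟩
  · rintro ⟨a, -, b, -, hua, hab, hbv, hneg, hz, hpos⟩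
    have hq : q ≠ 0 := by rintro rfl; simp at hpos
    obtain ⟨s, hs, hs0⟩ := p.exists_isRoot_of_mul_neg hab hneg
    have hst : s = t := by
      have hinj : Set.InjOn (fun t => p.eval t) (Set.Icc u v) :=
        hp.elim StrictMonoOn.injOn StrictAntiOn.injOn
      refine hinj ⟨(not_lt.1 hua).trans hs.1.le, hs.2.le.trans (not_lt.1 hbv)⟩
        ⟨hut.le, htv.le⟩ ?_
      exact hs0.eq_zero.trans ht.eq_zero.symm
    subst hst
    exact (pos_iff_pos_of_mul_pos (sign' hs.1 hs.2 hz hq)).2 hpos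

/-- A root of `p` that is not a root of `p'` is the only root in an interval between two samples
on which `p'` has no root. -/
theorem Polynomial.exists_isolating_interval {p : ℝ[X]} {t u v : ℝ} (ht : p.IsRoot t)
    (ht' : ¬ p.derivative.IsRoot t) {E : Finset ℝ} (hu : u ∈ E) (hv : v ∈ E) (hut : u < t)
    (htv : t < v) (hE : ∀ z, p.derivative.IsRoot z → z ∈ E) :
    ∃ a ∈ E, ∃ b ∈ E, (a < b ∧ (∀ z ∈ E, ¬ (p.derivative.eval z = 0 ∧ a < z ∧ z < b)) ∧
      p.eval a * p.eval b < 0) ∧ a < t ∧ t < b := by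
  obtain ⟨a, ha, b, hb, -, -, hat, htb, hab⟩ := E.exists_neighbors hu hv hut htv
  have hz : ∀ z ∈ E, ¬ (p.derivative.eval z = 0 ∧ a < z ∧ z < b) := by
    rintro z hz ⟨h0, haz, hzb⟩
    rw [hab z hz haz hzb] at h0
    exact ht' h0
  refine ⟨a, ha, b, hb, ⟨hat.trans htb, hz, ?_⟩, hat, htb⟩
  exact p.eval_mul_eval_neg_of_monotone (p.strictMonoOn_or_strictAntiOn_Icc fun z hz' h0 =>
    hz z (hE z h0) ⟨h0, hz'⟩) ht le_rfl hat htb le_rfl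

theorem Polynomial.abs_lt_of_isRoot_of_monic {p : ℝ[X]} (hp : p.Monic) {t : ℝ} (ht : p.IsRoot t) :
    |t| < 1 + ∑ i ∈ Finset.range p.natDegree, (1 + p.coeff i ^ 2) := by
  have h : (‖t‖₊ : ℝ) < cauchyBound p := ht.norm_lt_cauchyBound hp.ne_zero
  have hsup : (Finset.range p.natDegree).sup (fun i => ‖p.coeff i‖₊) ≤
      ∑ i ∈ Finset.range p.natDegree, ‖p.coeff i‖₊ :=
    Finset.sup_le fun i hi => Finset.single_le_sum (f := fun i => ‖p.coeff i‖₊)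
      (fun _ _ => zero_le) hi
  have hsum : ∑ i ∈ Finset.range p.natDegree, |p.coeff i| ≤
      ∑ i ∈ Finset.range p.natDegree, (1 + p.coeff i ^ 2) := by
    refine Finset.sum_le_sum fun i _ => ?_
    nlinarith [sq_abs (p.coeff i), sq_nonneg (|p.coeff i| - 1), sq_nonneg (|p.coeff i|)]
  rw [← NNReal.coe_le_coe] at hsup
  simp only [cauchyBound, hp.leadingCoeff, nnnorm_one, div_one, NNReal.coe_add, NNReal.coe_one,
    coe_nnnorm, Real.norm_eq_abs, NNReal.coe_sum] at h hsup
  linarith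

/-! ### Tame root functions -/

namespace tameSubalgebra

variable {ι : Type}

/-- The tame functions in `R` take every root of `f(x, ·)` as a value at `x`, for each `x` at which
the real polynomial `f(x, ·)` is not zero. -/
def CoversRoots (R : Finset (tameSubalgebra ι)) (f : (tameSubalgebra ι)[X]) : Prop :=
  ∀ x t, fiber f x ≠ 0 → (fiber f x).IsRoot t → ∃ r ∈ R, r.1 x = t

theorem fiber_derivative (f : (tameSubalgebra ι)[X]) (x : ι → ℝ) :
    fiber (derivative f) x = derivative (fiber f x) :=
  (derivative_map f _).symm

/-- The midpoint of two tame functions. -/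
noncomputable def mid (a b : tameSubalgebra ι) : tameSubalgebra ι := (2⁻¹ : ℝ) • (a + b)

@[simp] theorem mid_apply (a b : tameSubalgebra ι) (x : ι → ℝ) :
    (mid a b).1 x = (a.1 x + b.1 x) / 2 := by
  simp [mid, div_eq_inv_mul, mul_add]

/-- The points at which no sample from `E` strictly between `a` and `b` is a root of `q`. -/
theorem isSemialgebraic_no_root_between (E : Finset (tameSubalgebra ι)) (q : (tameSubalgebra ι)[X])
    (a b : tameSubalgebra ι) : IsSemialgebraic {x | ∀ z ∈ E,
      ¬ ((fiber q x).eval (z.1 x) = 0 ∧ a.1 x < z.1 x ∧ z.1 x < b.1 x)} := by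
  refine .biInter_finset E (A := fun z => {x |
    ¬ ((fiber q x).eval (z.1 x) = 0 ∧ a.1 x < z.1 x ∧ z.1 x < b.1 x)}) fun z _ => ?_
  have := ((isSemialgebraic_eq_zero (q.eval z)).inter
    ((isSemialgebraic_lt a z).inter (isSemialgebraic_lt z b))).compl
  simp only [evalAt_eval] at this
  exact this

theorem isSemialgebraic_mul_neg (f : (tameSubalgebra ι)[X]) (a b : tameSubalgebra ι) :
    IsSemialgebraic {x | (fiber f x).eval (a.1 x) * (fiber f x).eval (b.1 x) < 0} := by
  simpa using isSemialgebraic_lt (f.eval a * f.eval b) 0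

/-- If the roots of polynomials of degree at most `d` are covered by tame functions, then a
polynomial of any degree takes positive values on a semialgebraic set along a root `ρ` of a monic
polynomial `f` of degree `d + 1` that `u` and `v` isolate: division by `f` reduces the degree. -/
theorem isSemialgebraic_pos_of_isolated {d : ℕ}
    (ih : ∀ q : (tameSubalgebra ι)[X], q.natDegree ≤ d → ∃ R, CoversRoots R q)
    {f : (tameSubalgebra ι)[X]} (hf : f.Monic) (hd : f.natDegree = d + 1)
    (u v : tameSubalgebra ι) {G : Set (ι → ℝ)} (hG : IsSemialgebraic G) {ρ : (ι → ℝ) → ℝ}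
    (hρ : ∀ x ∈ G, (fiber f x).IsRoot (ρ x) ∧ u.1 x < ρ x ∧ ρ x < v.1 x)
    (hmono : ∀ x ∈ G, StrictMonoOn (fun t => (fiber f x).eval t) (Set.Icc (u.1 x) (v.1 x)) ∨
      StrictAntiOn (fun t => (fiber f x).eval t) (Set.Icc (u.1 x) (v.1 x)))
    (p : (tameSubalgebra ι)[X]) : IsSemialgebraic {x | x ∈ G ∧ 0 < (fiber p x).eval (ρ x)} := by
  classical
  have hq : (p %ₘ f).natDegree ≤ d := by
    have := natDegree_modByMonic_lt p hf (by rintro rfl; simp at hd)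
    omega
  obtain ⟨Z, hZ⟩ := ih _ hq
  generalize hq' : p %ₘ f = q at hZ
  set E := insert u (insert v Z) with hE
  have hS := hG.inter (.biUnion_finset E fun a _ => .biUnion_finset E fun b _ =>
    (isSemialgebraic_lt a u).compl.inter ((isSemialgebraic_lt a b).inter
      ((isSemialgebraic_lt v b).compl.inter ((isSemialgebraic_mul_neg f a b).inter
        ((isSemialgebraic_no_root_between E q a b).inter
          (isSemialgebraic_pos (q.eval (mid a b))))))))
  convert hS using 1
  ext x
  simp only [Set.mem_ofPred_eq, Set.mem_inter_iff, Set.mem_compl_iff, evalAt_eval, mid_apply]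
  refine and_congr_right fun hx => ?_
  obtain ⟨hroot, hu, hv⟩ := hρ x hx
  have hpq : (fiber p x).eval (ρ x) = (fiber q x).eval (ρ x) := by
    have h0 : eval (ρ x) (f.map (evalAt x)) = 0 := hroot
    conv_lhs => rw [← modByMonic_add_div p f, hq']
    simp [fiber, h0]
  rw [hpq, Polynomial.eval_pos_iff_of_isRoot (hmono x hx) hroot hu hv
    (E := E.image fun r => r.1 x) (by simp [hE]) (by simp [hE])]
  · simp only [Finset.exists_mem_image, Finset.forall_mem_image]
  · intro h0 z hz
    obtain ⟨r, hr, rfl⟩ := hZ x z h0 hz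
    exact Finset.mem_image_of_mem _ (by simp [hE, hr])

/-- An isolated root of a monic polynomial of degree `d + 1` is a tame function, if the roots of
polynomials of degree at most `d` are covered by tame functions. -/
theorem isTame_of_isolated {d : ℕ}
    (ih : ∀ (κ : Type) (q : (tameSubalgebra κ)[X]), q.natDegree ≤ d → ∃ R, CoversRoots R q)
    {f : (tameSubalgebra ι)[X]} (hf : f.Monic) (hd : f.natDegree = d + 1)
    (u v : tameSubalgebra ι) {G : Set (ι → ℝ)} (hG : IsSemialgebraic G) {ρ : (ι → ℝ) → ℝ}
    (hρ : ∀ x ∈ G, (fiber f x).IsRoot (ρ x) ∧ u.1 x < ρ x ∧ ρ x < v.1 x)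
    (hmono : ∀ x ∈ G, StrictMonoOn (fun t => (fiber f x).eval t) (Set.Icc (u.1 x) (v.1 x)) ∨
      StrictAntiOn (fun t => (fiber f x).eval t) (Set.Icc (u.1 x) (v.1 x)))
    (hρ' : ∀ x ∉ G, ρ x = 0) : IsTame ρ := by
  refine .of_polynomial fun κ π p => ?_
  have hG' : IsSemialgebraic {y : κ → ℝ | y ∘ π ∈ G} := hG.preimage_comp π
  have h₁ := isSemialgebraic_pos_of_isolated (ih κ) (hf.map (reindex π))
    ((hf.natDegree_map (reindex π)).trans hd) (reindex π u) (reindex π v) hG'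
    (ρ := fun y => ρ (y ∘ π))
    (fun y hy => by simpa only [fiber_reindex, reindex_apply] using hρ _ hy)
    (fun y hy => by simpa only [fiber_reindex, reindex_apply] using hmono _ hy) p
  convert h₁.union (hG'.compl.inter (isSemialgebraic_pos (p.eval 0))) using 1
  ext y
  by_cases hy : y ∘ π ∈ G
  · simp [hy]
  · simp [hy, hρ' _ hy]

/-- The induction step for monic polynomials: each root is a root of the derivative or isolated by
two functions among the roots of the derivative and the Cauchy bounds. -/
theorem exists_coversRoots_of_monic {d : ℕ}
    (ih : ∀ (κ : Type) (q : (tameSubalgebra κ)[X]), q.natDegree ≤ d → ∃ R, CoversRoots R q)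
    {f : (tameSubalgebra ι)[X]} (hf : f.Monic) (hd : f.natDegree = d + 1) :
    ∃ R, CoversRoots R f := by
  classical
  have hmonic (x : ι → ℝ) : (fiber f x).Monic := hf.map _
  have hdeg (x : ι → ℝ) : (fiber f x).natDegree = d + 1 := (hf.natDegree_map _).trans hd
  have hder (x : ι → ℝ) : fiber (derivative f) x ≠ 0 := by
    rw [fiber_derivative]
    intro h0
    have := derivative_eq_zero.1 h0
    rw [hdeg] at this
    omega
  obtain ⟨Z, hZ⟩ := ih ι (derivative f) ((natDegree_derivative_le f).trans (by omega))
  let m : tameSubalgebra ι := 1 + ∑ i ∈ Finset.range (d + 1), (1 + f.coeff i ^ 2)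
  have hm (x t) (ht : (fiber f x).IsRoot t) : (-m).1 x < t ∧ t < m.1 x := by
    have := Polynomial.abs_lt_of_isRoot_of_monic (hmonic x) ht
    have hmx : evalAt x m =
        1 + ∑ i ∈ Finset.range (d + 1), (1 + (fiber f x).coeff i ^ 2) := by
      simp [m, fiber, -evalAt_apply]
    rw [hdeg, ← hmx, abs_lt] at this
    exact this
  set E := insert m (insert (-m) Z) with hE
  have hZE (x z) (hz : (derivative (fiber f x)).IsRoot z) : z ∈ E.image fun r => r.1 x := by
    rw [← fiber_derivative] at hz
    obtain ⟨r, hr, rfl⟩ := hZ x z (hder x) hz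
    exact Finset.mem_image_of_mem _ (by simp [hE, hr])
  let G (u v : tameSubalgebra ι) : Set (ι → ℝ) := {x | u.1 x < v.1 x ∧
    (∀ z ∈ E, ¬ ((derivative (fiber f x)).eval (z.1 x) = 0 ∧ u.1 x < z.1 x ∧ z.1 x < v.1 x)) ∧
    (fiber f x).eval (u.1 x) * (fiber f x).eval (v.1 x) < 0}
  have hG (u v) : IsSemialgebraic (G u v) := by
    have := (isSemialgebraic_lt u v).inter
      ((isSemialgebraic_no_root_between E (derivative f) u v).inter
        (isSemialgebraic_mul_neg f u v))
    simp only [fiber_derivative] at this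
    exact this
  have hmono (u v x) (hx : x ∈ G u v) :
      StrictMonoOn (fun t => (fiber f x).eval t) (Set.Icc (u.1 x) (v.1 x)) ∨
        StrictAntiOn (fun t => (fiber f x).eval t) (Set.Icc (u.1 x) (v.1 x)) := by
    refine (fiber f x).strictMonoOn_or_strictAntiOn_Icc fun t ht h0 => ?_
    obtain ⟨r, hr, hrt⟩ := Finset.mem_image.1 (hZE x t h0)
    exact hx.2.1 r hr (hrt ▸ ⟨h0, ht⟩)
  have hex (u v) : ∃ ρ : tameSubalgebra ι, ∀ x ∈ G u v,
      (fiber f x).IsRoot (ρ.1 x) ∧ u.1 x < ρ.1 x ∧ ρ.1 x < v.1 x := by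
    have point (x) : ∃ t, (x ∈ G u v → (fiber f x).IsRoot t ∧ u.1 x < t ∧ t < v.1 x) ∧
        (x ∉ G u v → t = 0) := by
      by_cases hx : x ∈ G u v
      · obtain ⟨t, ht, h0⟩ := (fiber f x).exists_isRoot_of_mul_neg hx.1 hx.2.2
        exact ⟨t, fun _ => ⟨h0, ht⟩, fun h => absurd hx h⟩
      · exact ⟨0, fun h => absurd h hx, fun _ => rfl⟩
    choose ρ hρ hρ' using point
    exact ⟨⟨ρ, isTame_of_isolated ih hf hd u v (hG u v) hρ (hmono u v) hρ'⟩, hρ⟩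
  choose ρ hρ using hex
  refine ⟨Z ∪ (E ×ˢ E).image fun w => ρ w.1 w.2, fun x t _ ht => ?_⟩
  by_cases ht' : (derivative (fiber f x)).IsRoot t
  · rw [← fiber_derivative] at ht'
    obtain ⟨r, hr, hrt⟩ := hZ x t (hder x) ht'
    exact ⟨r, by simp [hr], hrt⟩
  · have := Polynomial.exists_isolating_interval ht ht' (E := E.image fun r => r.1 x)
      (Finset.mem_image_of_mem _ (a := -m) (by simp [hE]))
      (Finset.mem_image_of_mem _ (a := m) (by simp [hE])) (hm x t ht).1 (hm x t ht).2 (hZE x)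
    simp only [Finset.exists_mem_image, Finset.forall_mem_image] at this
    obtain ⟨u, hu, v, hv, hx, hut, htv⟩ := this
    have hxG : x ∈ G u v := hx
    obtain ⟨h0, h1, h2⟩ := hρ u v x hxG
    refine ⟨ρ u v, Finset.mem_union_right _
      (Finset.mem_image_of_mem (fun w : _ × _ => ρ w.1 w.2) (Finset.mk_mem_product hu hv)), ?_⟩
    have hinj : Set.InjOn (fun t => (fiber f x).eval t) (Set.Icc (u.1 x) (v.1 x)) :=
      (hmono u v x hxG).elim StrictMonoOn.injOn StrictAntiOn.injOn
    exact hinj ⟨h1.le, h2.le⟩ ⟨hut.le, htv.le⟩ (h0.eq_zero.trans ht.eq_zero.symm)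

/-- The roots of a polynomial with tame coefficients are given by finitely many tame functions. -/
theorem exists_coversRoots (d : ℕ) : ∀ (ι : Type) (f : (tameSubalgebra ι)[X]), f.natDegree ≤ d →
    ∃ R, CoversRoots R f := by
  classical
  induction d with
  | zero =>
    intro ι f hf
    refine ⟨∅, fun x t h0 ht => absurd ?_ h0⟩
    rw [eq_C_of_natDegree_le_zero hf] at ht ⊢
    simp only [fiber, map_C, IsRoot.def, eval_C] at ht ⊢
    rw [ht, C_0]
  | succ d ih =>
    intro ι f hf
    let c := f.coeff (d + 1)
    let c' : tameSubalgebra ι := ⟨fun x => (c.1 x)⁻¹, IsTame.inv c.2⟩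
    let h := f.erase (d + 1)
    have hfh : C c * X ^ (d + 1) + h = f := by
      rw [C_mul_X_pow_eq_monomial]
      exact f.monomial_add_erase (d + 1)
    have hh : h.natDegree ≤ d := by
      refine natDegree_le_iff_coeff_eq_zero.2 fun n hn => ?_
      rw [coeff_erase]
      split_ifs with hnd
      · rfl
      · exact coeff_eq_zero_of_natDegree_lt (by omega)
    have hdeg : (C c' * h).degree < (d + 1 : ℕ) :=
      degree_le_natDegree.trans_lt
        (Nat.cast_lt.2 ((natDegree_C_mul_le _ _).trans_lt (by omega)))
    have hmonic : (X ^ (d + 1) + C c' * h).Monic := monic_X_pow_add hdeg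
    have hnat : (X ^ (d + 1) + C c' * h).natDegree = d + 1 := by
      refine natDegree_eq_of_degree_eq_some ?_
      rw [degree_add_eq_left_of_degree_lt (by rwa [degree_X_pow]), degree_X_pow]
    obtain ⟨R₁, hR₁⟩ := exists_coversRoots_of_monic ih hmonic hnat
    obtain ⟨R₂, hR₂⟩ := ih ι h hh
    refine ⟨R₁ ∪ R₂, fun x t hx ht => ?_⟩
    have hfx : C (c.1 x) * X ^ (d + 1) + fiber h x = fiber f x := by
      rw [← hfh]
      simp [fiber]
    -- Where the leading coefficient `c` vanishes, `c'` has the value `0⁻¹ = 0` and says nothing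
    -- about `f`, but there `f` agrees with `h`.
    by_cases hc : c.1 x = 0
    · rw [hc, C_0, zero_mul, zero_add] at hfx
      obtain ⟨r, hr, hrt⟩ := hR₂ x t (hfx ▸ hx) (hfx ▸ ht)
      exact ⟨r, Finset.mem_union_right _ hr, hrt⟩
    · have hgx : fiber (X ^ (d + 1) + C c' * h) x = C (c.1 x)⁻¹ * fiber f x := by
        rw [← hfx, mul_add, ← mul_assoc, ← C_mul, inv_mul_cancel₀ hc]
        simp [fiber, c']
      obtain ⟨r, hr, hrt⟩ := hR₁ x t (hgx ▸ mul_ne_zero (C_ne_zero.2 (inv_ne_zero hc)) hx)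
        (by rw [hgx, IsRoot.def, eval_mul, ht.eq_zero, mul_zero])
      exact ⟨r, Finset.mem_union_left _ hr, hrt⟩

end tameSubalgebra

/-! ### Projections -/

namespace IsSemialgebraic

variable {ι : Type}

open tameSubalgebra

/-- Membership in a semialgebraic set depends only on the signs of finitely many polynomials. -/
theorem exists_finset_polynomial {S : Set (Option ι → ℝ)} (hS : IsSemialgebraic S) :
    ∃ F : Finset (tameSubalgebra ι)[X], ∀ x t t',
      (∀ p ∈ F, SignType.sign ((fiber p x).eval t) = SignType.sign ((fiber p x).eval t')) →
        (snocPoint x t ∈ S ↔ snocPoint x t' ∈ S) := by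
  classical
  induction hS with
  | zeroSet P =>
    refine ⟨{ofMvPolynomial P}, fun x t t' h => ?_⟩
    have := h _ (Finset.mem_singleton_self _)
    simp only [Set.mem_ofPred_eq, ← eval_fiber_ofMvPolynomial]
    rw [← sign_eq_zero_iff, this, sign_eq_zero_iff]
  | posSet P =>
    refine ⟨{ofMvPolynomial P}, fun x t t' h => ?_⟩
    have := h _ (Finset.mem_singleton_self _)
    simp only [Set.mem_ofPred_eq, ← eval_fiber_ofMvPolynomial]
    rw [← sign_eq_one_iff, this, sign_eq_one_iff]
  | union _ _ hA hB =>
    obtain ⟨F, hF⟩ := hA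
    obtain ⟨F', hF'⟩ := hB
    exact ⟨F ∪ F', fun x t t' h => or_congr
      (hF x t t' fun p hp => h p (Finset.mem_union_left _ hp))
      (hF' x t t' fun p hp => h p (Finset.mem_union_right _ hp))⟩
  | inter _ _ hA hB =>
    obtain ⟨F, hF⟩ := hA
    obtain ⟨F', hF'⟩ := hB
    exact ⟨F ∪ F', fun x t t' h => and_congr
      (hF x t t' fun p hp => h p (Finset.mem_union_left _ hp))
      (hF' x t t' fun p hp => h p (Finset.mem_union_right _ hp))⟩
  | compl _ hA =>
    obtain ⟨F, hF⟩ := hA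
    exact ⟨F, fun x t t' h => not_congr (hF x t t' h)⟩

/-- Each real number is an element of a nonempty finite set `E`, or has no element of `E` between
itself and one of the finitely many samples `(a + b) / 2`, `a + 1`, `a - 1`. -/
theorem _root_.Finset.exists_sample {E : Finset ℝ} (hE : E.Nonempty) (t : ℝ) :
    t ∈ E ∨ ∃ a ∈ E, ∃ b ∈ E, ∃ s, (s = (a + b) / 2 ∨ s = a + 1 ∨ s = a - 1) ∧
      ∀ z ∈ E, z ∉ Set.uIcc t s := by
  have hmax := E.max'_mem hE
  have hmin := E.min'_mem hE
  refine or_iff_not_imp_left.2 fun ht => ?_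
  by_cases h₁ : E.max' hE < t
  · refine ⟨_, hmax, _, hmax, _, .inr (.inl rfl), fun z hz hzt => ?_⟩
    have := E.le_max' z hz
    rcases Set.mem_uIcc.1 hzt with h | h <;> linarith
  by_cases h₂ : t < E.min' hE
  · refine ⟨_, hmin, _, hmin, _, .inr (.inr rfl), fun z hz hzt => ?_⟩
    have := E.min'_le z hz
    rcases Set.mem_uIcc.1 hzt with h | h <;> linarith
  have h₁' : t < E.max' hE := lt_of_le_of_ne (not_lt.1 h₁) fun h => ht (h ▸ hmax)
  have h₂' : E.min' hE < t := lt_of_le_of_ne (not_lt.1 h₂) fun h => ht (h ▸ hmin)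
  obtain ⟨a, ha, b, hb, -, -, hat, htb, hab⟩ := E.exists_neighbors hmin hmax h₂' h₁'
  refine ⟨a, ha, b, hb, _, .inl rfl, fun z hz hzt => ht ?_⟩
  rw [← hab z hz _ _]
  · exact hz
  all_goals rcases Set.mem_uIcc.1 hzt with h | h <;> linarith

/-- A semialgebraic set has a nonempty fiber over `x` exactly if one of finitely many tame
functions takes a value in it. -/
theorem exists_samples {S : Set (Option ι → ℝ)} (hS : IsSemialgebraic S) :
    ∃ T : Finset (tameSubalgebra ι), ∀ x t, snocPoint x t ∈ S →
      ∃ s ∈ T, snocPoint x (s.1 x) ∈ S := by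
  classical
  obtain ⟨F, hF⟩ := hS.exists_finset_polynomial
  choose R hR using fun p : (tameSubalgebra ι)[X] => exists_coversRoots p.natDegree ι p le_rfl
  -- The function `0` only makes the set of roots nonempty.
  let E := insert 0 (F.biUnion R)
  refine ⟨E ∪ ((E ×ˢ E).image fun w => mid w.1 w.2) ∪ E.image (· + 1) ∪ E.image (· - 1),
    fun x t ht => ?_⟩
  have hne : (E.image fun r => r.1 x).Nonempty := ⟨_, Finset.mem_image_of_mem _
    (Finset.mem_insert_self _ _)⟩
  rcases Finset.exists_sample hne t with h | ⟨a, ha, b, hb, s, hs, hgap⟩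
  · obtain ⟨r, hr, rfl⟩ := Finset.mem_image.1 h
    exact ⟨r, by simp [hr], ht⟩
  · have hst : snocPoint x s ∈ S := by
      refine (hF x t s fun p hp => ?_).1 ht
      by_cases h0 : fiber p x = 0
      · simp [h0]
      have hpos : 0 < (fiber p x).eval t * (fiber p x).eval s := by
        have hno : ∀ z ∈ Set.uIcc t s, (fiber p x).eval z ≠ 0 := by
          intro z hz hz0
          obtain ⟨r, hr, rfl⟩ := hR p x z h0 hz0
          exact hgap _ (Finset.mem_image_of_mem (fun r : tameSubalgebra ι => r.1 x)
            (Finset.mem_insert_of_mem (Finset.mem_biUnion.2 ⟨p, hp, hr⟩))) hz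
        rcases le_total t s with hts | hts
        · rw [Set.uIcc_of_le hts] at hno
          exact (fiber p x).eval_mul_eval_pos_of_forall_ne_zero hts hno
        · rw [Set.uIcc_of_ge hts] at hno
          rw [mul_comm]
          exact (fiber p x).eval_mul_eval_pos_of_forall_ne_zero hts hno
      rcases mul_pos_iff.1 hpos with ⟨h₁, h₂⟩ | ⟨h₁, h₂⟩
      · rw [sign_pos h₁, sign_pos h₂]
      · rw [sign_neg h₁, sign_neg h₂]
    obtain ⟨a, haE, rfl⟩ := Finset.mem_image.1 ha
    obtain ⟨b, hbE, rfl⟩ := Finset.mem_image.1 hb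
    rcases hs with rfl | rfl | rfl
    · refine ⟨mid a b, ?_, by simpa using hst⟩
      have := Finset.mem_image_of_mem
        (fun w : _ × _ => mid w.1 w.2) (Finset.mk_mem_product haE hbE)
      simp only [Finset.mem_union]
      exact .inl (.inl (.inr this))
    · refine ⟨a + 1, ?_, by simpa using hst⟩
      have := Finset.mem_image_of_mem (· + 1) haE
      simp only [Finset.mem_union]
      exact .inl (.inr this)
    · refine ⟨a - 1, ?_, by simpa using hst⟩
      have := Finset.mem_image_of_mem (· - 1) haE
      simp only [Finset.mem_union]
      exact .inr this

/-- The projection of a semialgebraic set along one coordinate is semialgebraic. -/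
theorem exists_snocPoint {S : Set (Option ι → ℝ)} (hS : IsSemialgebraic S) :
    IsSemialgebraic {x : ι → ℝ | ∃ t, snocPoint x t ∈ S} := by
  obtain ⟨T, hT⟩ := hS.exists_samples
  convert biUnion_finset T fun s _ => s.2.isSemialgebraic_mem hS using 1
  ext x
  exact ⟨fun ⟨t, ht⟩ => hT x t ht, fun ⟨s, _, hs⟩ => ⟨_, hs⟩⟩

/-- The Tarski–Seidenberg theorem: projections of semialgebraic sets along finitely many
coordinates are semialgebraic. -/
theorem exists_sumElim {m : ℕ} {S : Set (Fin m ⊕ ι → ℝ)} (hS : IsSemialgebraic S) :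
    IsSemialgebraic {y : ι → ℝ | ∃ x : Fin m → ℝ, Sum.elim x y ∈ S} := by
  induction m with
  | zero =>
    convert hS.preimage_comp (Sum.elim Fin.elim0 id) using 1
    ext y
    have (x : Fin 0 → ℝ) : Sum.elim x y = y ∘ Sum.elim Fin.elim0 id := by
      ext (i | i)
      · exact i.elim0
      · rfl
    simp [this]
  | succ m ih =>
    let π : Fin (m + 1) ⊕ ι → Option (Fin m ⊕ ι) :=
      Sum.elim (Fin.cases none fun i => some (.inl i)) fun i => some (.inr i)
    convert ih (hS.preimage_comp π).exists_snocPoint using 1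
    ext y
    have (t : ℝ) (x : Fin m → ℝ) : snocPoint (Sum.elim x y) t ∘ π = Sum.elim (Fin.cons t x) y := by
      ext (i | i)
      · cases i using Fin.cases <;> rfl
      · rfl
    simp only [Set.mem_ofPred_eq, Fin.exists_fin_succ_pi, this]
    exact exists_comm

end IsSemialgebraic

/-! ### The points at which a map is not proper -/

/-- A continuous map is not proper at `y` exactly if there are points of arbitrarily large norm
whose images are arbitrarily close to `y`; one parameter `ε` measures both. -/
theorem mem_nonProperPoints_iff {M N : Type*} [NormedAddCommGroup M] [ProperSpace M]
    [PseudoMetricSpace N] {Y : M → N} (hY : Continuous Y) (y : N) :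
    y ∈ nonProperPoints Y ↔ ∀ ε > 0, ∃ x, 1 < ε * ‖x‖ ∧ dist (Y x) y < ε := by
  rw [nonProperPoints, Set.mem_ofPred_eq]
  constructor
  · intro h ε hε
    by_contra! hbd
    refine h ⟨Metric.ball y (ε / 2), Metric.ball_mem_nhds y (by positivity), ?_⟩
    refine (isCompact_closedBall (0 : M) (1 / ε)).of_isClosed_subset
      (isClosed_closure.preimage hY) fun x hx => ?_
    have hx' : dist (Y x) y ≤ ε / 2 := Metric.closure_ball_subset_closedBall hx
    rw [mem_closedBall_zero_iff, le_div_iff₀ hε, mul_comm]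
    by_contra! hlt
    linarith [hbd x hlt]
  · rintro h ⟨U, hU, hc⟩
    obtain ⟨δ, hδ, hball⟩ := Metric.mem_nhds_iff.1 hU
    obtain ⟨C, hC, hbd⟩ := hc.isBounded.exists_pos_norm_le
    obtain ⟨x, hx, hdist⟩ := h (min δ C⁻¹) (lt_min hδ (inv_pos.2 hC))
    have hxC : ‖x‖ ≤ C :=
      hbd x (subset_closure (hball (Metric.mem_ball.2 (hdist.trans_le (min_le_left _ _)))))
    have : min δ C⁻¹ * ‖x‖ ≤ C⁻¹ * C := by
      gcongr
      exact min_le_right _ _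
    rw [inv_mul_cancel₀ hC.ne'] at this
    linarith

/-- Non-properness at `y`, written with polynomial inequalities in the coordinates. -/
theorem mem_nonProperPoints_iff_coord {n : ℕ} {Y : (Fin n → ℝ) → (Fin n → ℝ)}
    (hY : Continuous Y) (y : Fin n → ℝ) :
    y ∈ nonProperPoints Y ↔ ∀ ε > 0, ∃ x z : Fin n → ℝ, Y x = z ∧
      (∃ i, 1 < (ε * x i) ^ 2) ∧ ∀ i, (z i - y i) ^ 2 < ε ^ 2 := by
  rw [mem_nonProperPoints_iff hY]
  refine forall₂_congr fun ε hε => exists_congr fun x => ?_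
  rw [exists_eq_left']
  refine and_congr ?_ ?_
  · rw [← not_iff_not, not_lt, mul_comm, ← le_div_iff₀ hε,
      pi_norm_le_iff_of_nonneg (by positivity)]
    push Not
    refine forall_congr' fun i => ?_
    rw [sq_le_one_iff_abs_le_one, abs_mul, abs_of_pos hε, le_div_iff₀ hε, mul_comm,
      Real.norm_eq_abs]
  · rw [dist_pi_lt_iff hε]
    refine forall_congr' fun i => ?_
    rw [sq_lt_sq, abs_of_pos hε, Real.dist_eq]

theorem proposition4p5 (n : ℕ) (Y : (Fin n → ℝ) → (Fin n → ℝ)) (hcont : Continuous Y)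
    (hY : IsSemialgebraicMap Y) : IsSemialgebraic (nonProperPoints Y) := by
  -- The variables are, in this order: the value `z`, the point `x`, and `ε` together with `y`.
  let e : Fin n ⊕ (Fin n ⊕ Option (Fin n)) := .inr (.inr none)
  have hgraph : IsSemialgebraic {u : Fin n ⊕ (Fin n ⊕ Option (Fin n)) → ℝ |
      Y (fun i => u (.inr (.inl i))) = fun i => u (.inl i)} :=
    hY.preimage_comp (Sum.elim (fun i => Sum.inr (Sum.inl i)) Sum.inl)
  have hlarge : IsSemialgebraic {u : Fin n ⊕ (Fin n ⊕ Option (Fin n)) → ℝ |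
      ∃ i ∈ Finset.univ, 1 < (u e * u (.inr (.inl i))) ^ 2} :=
    .biUnion_finset _ (A := fun i => {u | 1 < (u e * u (.inr (.inl i))) ^ 2}) fun i _ => by
      convert IsSemialgebraic.posSet
        ((MvPolynomial.X e * MvPolynomial.X (.inr (.inl i))) ^ 2 - 1 :
          MvPolynomial (Fin n ⊕ (Fin n ⊕ Option (Fin n))) ℝ) using 2 with u
      simp only [map_sub, map_pow, map_mul, map_one, MvPolynomial.eval_X, sub_pos]
  have hclose : IsSemialgebraic {u : Fin n ⊕ (Fin n ⊕ Option (Fin n)) → ℝ |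
      ∀ i ∈ Finset.univ, (u (.inl i) - u (.inr (.inr (some i)))) ^ 2 < u e ^ 2} :=
    .biInter_finset _ (A := fun i => {u | (u (.inl i) - u (.inr (.inr (some i)))) ^ 2 < u e ^ 2})
      fun i _ => by
        convert IsSemialgebraic.posSet (MvPolynomial.X e ^ 2 -
          (MvPolynomial.X (.inl i) - MvPolynomial.X (.inr (.inr (some i)))) ^ 2 :
            MvPolynomial (Fin n ⊕ (Fin n ⊕ Option (Fin n))) ℝ) using 2 with u
        simp only [map_sub, map_pow, MvPolynomial.eval_X, sub_pos]
  have hpos : IsSemialgebraic {w : Option (Fin n) → ℝ | 0 < w none} := by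
    simpa using IsSemialgebraic.posSet (MvPolynomial.X none : MvPolynomial (Option (Fin n)) ℝ)
  convert (hpos.inter ((hgraph.inter
    (hlarge.inter hclose)).exists_sumElim.exists_sumElim.compl)).exists_snocPoint.compl using 1
  ext y
  rw [mem_nonProperPoints_iff_coord hcont]
  simp [e]
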